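/- **Lemma 4.1.** Let $U, W \subset \mathbb{C}$ be open discs with $0 \in W$, let $s \ge 1$, and let $a_0(t,\varepsilon), \dots, a_{n-1}(t,\varepsilon)$ be holomorphic on the polydisc $U \times W$. Suppose that the linear differential equation in $t$, with parameter $\varepsilon$, $$\varepsilon^s y^{(n)} + a_{n-1}(t,\varepsilon)\, y^{(n-1)} + \dots + a_0(t,\varepsilon)\, y = 0 \qquad (*)$$ is singularly perturbed, that is, $a_k(\cdot,0) \not\equiv 0$ on $U$ for some $k$, $0 \le k \le n-1$. Then there is a discrete subset $D \subset U$ (with no accumulation point in $U$) such that for every $t_0 \in U \setminus D$ there exists a solution $y(t,\varepsilon)$ of $(*)$, holomorphic on $U \times (W \setminus \{0\})$, with the following two properties (derivatives are with respect to $t$): 1. the initial data $y(t_0,\varepsilon), y'(t_0,\varepsilon), \dots, y^{(n-1)}(t_0,\varepsilon)$ do not depend on $\varepsilon \in W \setminus \{0\}$; 2. there is an at most countable set $E \subset U$ such that for every $t_1 \in U \setminus E$ the function $\varepsilon \mapsto y(t_1,\varepsilon)$ has an essential singularity at $\varepsilon = 0$. -/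

import Mathlib

open Topology Filter

/-- The family of linear differential equations
`ε ^ s * y⁽ⁿ⁾ + a_{n-1}(t, ε) * y⁽ⁿ⁻¹⁾ + ⋯ + a_0(t, ε) * y = 0`, with coefficients holomorphic on
`U × W`, is singularly perturbed: `s ≥ 1`, and some coefficient `a_k(·, 0)`, `0 ≤ k ≤ n - 1`, is not
identically zero on `U`. -/
structure IsSingularlyPerturbed {n : ℕ} (s : ℕ) (a : Fin n → ℂ → ℂ → ℂ) (U W : Set ℂ) : Prop where
  one_le : 1 ≤ s
  holomorphic : ∀ i, DifferentiableOn ℂ (fun p : ℂ × ℂ => a i p.1 p.2) (U ×ˢ W)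
  exists_ne_zero : ∃ k, ∃ t ∈ U, a k t 0 ≠ 0

/-- `y(t, ε)` is a parameter dependent solution, jointly holomorphic in `(t, ε) ∈ U × V`, of
`ε ^ s * y⁽ⁿ⁾ + a_{n-1}(t, ε) * y⁽ⁿ⁻¹⁾ + ⋯ + a_0(t, ε) * y = 0`; the derivatives are taken with
respect to `t`. The set `U × V` is meant to be open. -/
structure IsParamSolution {n : ℕ} (s : ℕ) (a : Fin n → ℂ → ℂ → ℂ) (U V : Set ℂ)
    (y : ℂ → ℂ → ℂ) : Prop where
  holomorphic : DifferentiableOn ℂ (fun p : ℂ × ℂ => y p.1 p.2) (U ×ˢ V)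
  equation : ∀ t ∈ U, ∀ ε ∈ V,
    ε ^ s * iteratedDeriv n (fun τ => y τ ε) t
      + ∑ i : Fin n, a i t ε * iteratedDeriv (i : ℕ) (fun τ => y τ ε) t = 0

/-- `f` has an essential singularity at `z₀`: it is holomorphic in a punctured neighbourhood of
`z₀`, and the isolated singularity at `z₀` is neither removable nor a pole. -/
def HasEssentialSingularityAt (f : ℂ → ℂ) (z₀ : ℂ) : Prop :=
  (∀ᶠ z in 𝓝[≠] z₀, DifferentiableAt ℂ f z) ∧ ¬ MeromorphicAt f z₀

/-! Let `m` be the largest index with `a_m(·, 0) ≢ 0`, and let `D` be the zero set of `a_m(·, 0)`.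
For `t₀ ∉ D`, take the solution whose initial data at `t₀` are the `m`-th unit vector for every `ε ≠
0`. These data violate the limit equation `∑ a_i(t, 0) y⁽ⁱ⁾ = 0` at `t₀`.

Expand `y(t, ·)` in a Laurent series at `0`, and let `C_k(t)` be the coefficient of `ε ^ (-k)`. If
`C_k ≡ 0` for all `k > K`, comparing coefficients of `ε ^ (-K)` shows that `C_K` solves the limit
equation: since `s ≥ 1`, the leading term contributes only coefficients of index above `K`. For `K ≥
1` the initial data of `C_K` at `t₀` vanish, because those of `y` are constant in `ε`. As `a_m(t₀,
0) ≠ 0`, this forces `C_K ≡ 0`. So if only finitely many `C_k` with `k ≥ 1` were nonzero, descent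
would kill them all, and `C_0` would satisfy the limit equation at `t₀`, contrary to the choice of
data.

Hence infinitely many `C_k` are not identically zero, and each has countably many zeros. A `t` at
which `y(t, ·)` is meromorphic at `0` is a zero of all but finitely many `C_k`, so such `t` form a
countable set. This is `IsParamSolution.countable_setOf_meromorphicAt`; the solution itself comes
from `exists_isParamSolution`, by Picard iteration that is holomorphic in the parameter. -/

/-! ### Joint holomorphy and integrals depending on a parameter -/

open Set Metric in
/-- The derivative of a family of holomorphic functions that depends continuously on a parameter
is jointly continuous. -/
theorem continuousOn_deriv_of_continuousOn_uncurry {X E : Type*} [TopologicalSpace X]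
    [NormedAddCommGroup E] [NormedSpace ℂ E] [CompleteSpace E] {S : Set X} {Ω : Set ℂ}
    (hΩ : IsOpen Ω) {f : X → ℂ → E} (hf : ContinuousOn (Function.uncurry f) (S ×ˢ Ω))
    (hd : ∀ x ∈ S, DifferentiableOn ℂ (f x) Ω) :
    ContinuousOn (fun p : X × ℂ => deriv (f p.1) p.2) (S ×ˢ Ω) := by
  rintro ⟨x₀, z₀⟩ ⟨hx₀, hz₀⟩
  have hfst : Tendsto (Prod.fst : X × ℂ → X) (𝓝[S ×ˢ Ω] (x₀, z₀)) (𝓝[S] x₀) := by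
    rw [nhdsWithin_prod_eq]; exact tendsto_fst
  have hsnd : Tendsto (Prod.snd : X × ℂ → ℂ) (𝓝[S ×ˢ Ω] (x₀, z₀)) (𝓝[Ω] z₀) := by
    rw [nhdsWithin_prod_eq]; exact tendsto_snd
  -- Joint continuity makes nearby slices uniformly close on compact sets; Weierstrass' theorem then
  -- carries the convergence over to derivatives.
  have hlim : TendstoLocallyUniformlyOn (fun p : X × ℂ => f p.1) (f x₀)
      (𝓝[S ×ˢ Ω] (x₀, z₀)) Ω := by
    rw [tendstoLocallyUniformlyOn_iff_forall_isCompact hΩ]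
    intro K hKΩ hK u hu
    obtain ⟨v, hv, hvu⟩ := hK.mem_uniformity_of_prod
      (hf.mono (prod_mono_right hKΩ)) hx₀ (symm_le_uniformity hu)
    filter_upwards [hfst hv] with p hp x hx
    exact hvu p.1 hp x hx
  have hev : ∀ᶠ p : X × ℂ in 𝓝[S ×ˢ Ω] (x₀, z₀), DifferentiableOn ℂ (f p.1) Ω := by
    filter_upwards [self_mem_nhdsWithin] with p hp using hd p.1 hp.1
  exact (hlim.deriv hev hΩ).tendsto_comp
    (((hd x₀ hx₀).deriv hΩ).continuousOn z₀ hz₀) hz₀ hsnd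

open Set Metric in
/-- **Osgood's lemma** on a product of two open subsets of the plane: a continuous, separately
holomorphic function is holomorphic. -/
theorem differentiableOn_prod_of_separately {E : Type*} [NormedAddCommGroup E] [NormedSpace ℂ E]
    [CompleteSpace E] {U V : Set ℂ} (hU : IsOpen U) (hV : IsOpen V) {f : ℂ × ℂ → E}
    (hf : ContinuousOn f (U ×ˢ V))
    (h₁ : ∀ w ∈ V, DifferentiableOn ℂ (fun z => f (z, w)) U)
    (h₂ : ∀ z ∈ U, DifferentiableOn ℂ (fun w => f (z, w)) V) :
    DifferentiableOn ℂ f (U ×ˢ V) := by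
  have c₂ : ContinuousOn (fun p : ℂ × ℂ => deriv (fun w => f (p.1, w)) p.2) (U ×ˢ V) :=
    continuousOn_deriv_of_continuousOn_uncurry (f := fun z w => f (z, w)) hV hf h₂
  have hswap : ContinuousOn (Function.uncurry fun w z => f (z, w)) (V ×ˢ U) :=
    hf.comp continuous_swap.continuousOn fun p hp => ⟨hp.2, hp.1⟩
  have c₁ : ContinuousOn (fun p : ℂ × ℂ => deriv (fun z => f (z, p.2)) p.1) (U ×ˢ V) :=
    (continuousOn_deriv_of_continuousOn_uncurry (f := fun w z => f (z, w)) hU hswap h₁).comp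
      continuous_swap.continuousOn fun p hp => ⟨hp.2, hp.1⟩
  intro p hp
  have hmem : U ×ˢ V ∈ 𝓝 p := (hU.prod hV).mem_nhds hp
  have hspan := (ContinuousLinearMap.toSpanSingletonCLE (𝕜 := ℂ) (E := E)).continuous
  -- Both partial derivatives exist and are jointly continuous, which gives strict
  -- differentiability.
  refine (hasStrictFDerivAt_uncurry_coprod (𝕜 := ℂ) (f := fun z w => f (z, w))
    (f₁ := fun z w => ContinuousLinearMap.toSpanSingleton ℂ (deriv (fun z => f (z, w)) z))
    (f₂ := fun z w => ContinuousLinearMap.toSpanSingleton ℂ (deriv (fun w => f (z, w)) w))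
    (u := p) ?_ ?_ ?_ ?_).hasFDerivAt.differentiableAt.differentiableWithinAt
  · filter_upwards [hmem] with q hq
    exact ((h₁ q.2 hq.2).differentiableAt (hU.mem_nhds hq.1)).hasDerivAt.hasFDerivAt
  · filter_upwards [hmem] with q hq
    exact ((h₂ q.1 hq.1).differentiableAt (hV.mem_nhds hq.2)).hasDerivAt.hasFDerivAt
  · exact hspan.continuousAt.comp (c₁.continuousAt hmem)
  · exact hspan.continuousAt.comp (c₂.continuousAt hmem)

open Set Metric in
/-- Differentiation under the integral sign for holomorphic dependence on a parameter. -/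
theorem hasDerivAt_intervalIntegral_of_differentiableOn {E : Type*} [NormedAddCommGroup E]
    [NormedSpace ℂ E] [CompleteSpace E] {Ω : Set ℂ} (hΩ : IsOpen Ω) {a b : ℝ} {F : ℂ → ℝ → E}
    (hF : ContinuousOn (Function.uncurry fun x z => F z x) (uIcc a b ×ˢ Ω))
    (hd : ∀ x ∈ uIcc a b, DifferentiableOn ℂ (fun z => F z x) Ω) {z₀ : ℂ} (hz₀ : z₀ ∈ Ω) :
    HasDerivAt (fun z => ∫ x in a..b, F z x) (∫ x in a..b, deriv (fun z => F z x) z₀) z₀ := by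
  have hcont := continuousOn_deriv_of_continuousOn_uncurry (f := fun x z => F z x) hΩ hF hd
  obtain ⟨δ, hδ, hδΩ⟩ := nhds_basis_closedBall.mem_iff.1 (hΩ.mem_nhds hz₀)
  obtain ⟨M, hM⟩ := (isCompact_uIcc.prod (isCompact_closedBall z₀ δ)).exists_bound_of_continuousOn
    (hcont.mono (prod_mono_right hδΩ))
  have hslice : ∀ z ∈ Ω, ContinuousOn (F z) (uIcc a b) := fun z hz =>
    hF.comp (f := fun x => (x, z)) (by fun_prop) fun x hx => ⟨hx, hz⟩
  have hslice' : ContinuousOn (fun x => deriv (fun z => F z x) z₀) (uIcc a b) :=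
    hcont.comp (f := fun x => (x, z₀)) (by fun_prop) fun x hx => ⟨hx, hz₀⟩
  refine (intervalIntegral.hasDerivAt_integral_of_dominated_loc_of_deriv_le
    (F' := fun z x => deriv (fun z => F z x) z) (bound := fun _ => M)
    (closedBall_mem_nhds z₀ hδ) ?_ (hslice z₀ hz₀).intervalIntegrable ?_ ?_ ?_ ?_).2
  · filter_upwards [hΩ.mem_nhds hz₀] with z hz
    exact ((hslice z hz).mono uIoc_subset_uIcc).aestronglyMeasurable measurableSet_uIoc
  · exact (hslice'.mono uIoc_subset_uIcc).aestronglyMeasurable measurableSet_uIoc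
  · exact .of_forall fun x hx z hz => hM (x, z) ⟨uIoc_subset_uIcc hx, hz⟩
  · exact intervalIntegrable_const
  · exact .of_forall fun x hx z hz =>
      ((hd x (uIoc_subset_uIcc hx)).differentiableAt (hΩ.mem_nhds (hδΩ hz))).hasDerivAt

open Set Metric in
theorem continuousOn_intervalIntegral_of_continuousOn {X E : Type*} [TopologicalSpace X]
    [FirstCountableTopology X] [NormedAddCommGroup E] [NormedSpace ℝ E] {S : Set X} {a b : ℝ}
    (hab : a ≤ b) {f : X → ℝ → E} (hf : ContinuousOn (Function.uncurry f) (S ×ˢ Icc a b)) :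
    ContinuousOn (fun p => ∫ x in a..b, f p x) S := by
  rw [continuousOn_iff_continuous_domRestrict]
  -- Composing with the projection onto `[a, b]` extends the integrand continuously to all real `x`
  -- without changing the integral.
  have key : Continuous fun p : S => ∫ x in a..b, f p (projIcc a b hab x) := by
    refine intervalIntegral.continuous_parametric_intervalIntegral_of_continuous' ?_ a b
    exact hf.comp_continuous (f := fun q : S × ℝ => ((q.1 : X), (projIcc a b hab q.2 : ℝ)))
      (by fun_prop) fun q => ⟨q.1.2, (projIcc a b hab q.2).2⟩
  refine key.congr fun p => intervalIntegral.integral_congr fun x hx => ?_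
  rw [uIcc_of_le hab] at hx
  simp [projIcc_of_mem hab hx]

/-! ### Integration along segments -/

/-- The integral of `f(·, ε)` along the segment from `t₀` to `t`, as a function of `(t, ε)`. -/
noncomputable def segmentIntegral {E : Type*} [NormedAddCommGroup E] [NormedSpace ℂ E]
    (t₀ : ℂ) (f : ℂ × ℂ → E) (p : ℂ × ℂ) : E :=
  ∫ x in (0 : ℝ)..1, (p.1 - t₀) • f (t₀ + x * (p.1 - t₀), p.2)

section SegmentIntegral

open Set Metric

variable {E : Type*} [NormedAddCommGroup E] [NormedSpace ℂ E]
  {c t₀ : ℂ} {r : ℝ} {V : Set ℂ} {f : ℂ × ℂ → E}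

theorem add_mul_sub_mem_of_convex {s : Set ℂ} (hs : Convex ℝ s) {z w : ℂ} (hz : z ∈ s)
    (hw : w ∈ s) {x : ℝ} (hx : x ∈ Icc (0 : ℝ) 1) : z + x * (w - z) ∈ s := by
  simpa using hs.add_smul_sub_mem hz hw hx

theorem continuousOn_segmentIntegrand (ht₀ : t₀ ∈ ball c r)
    (hf : ContinuousOn f (ball c r ×ˢ V)) :
    ContinuousOn (fun q : (ℂ × ℂ) × ℝ =>
      (q.1.1 - t₀) • f (t₀ + q.2 * (q.1.1 - t₀), q.1.2)) ((ball c r ×ˢ V) ×ˢ Icc (0 : ℝ) 1) := by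
  refine ContinuousOn.smul (by fun_prop) (hf.comp (f := fun q : (ℂ × ℂ) × ℝ =>
    (t₀ + q.2 * (q.1.1 - t₀), q.1.2)) (by fun_prop) ?_)
  exact fun q hq => ⟨add_mul_sub_mem_of_convex (convex_ball c r) ht₀ hq.1.1 hq.2, hq.1.2⟩

/-- On a disc the slice `f(·, ε)` has a primitive `G`, and the segment integral equals `G τ - G t₀`.
-/
theorem hasDerivAt_segmentIntegral [CompleteSpace E] (ht₀ : t₀ ∈ ball c r)
    (hf : DifferentiableOn ℂ f (ball c r ×ˢ V)) {t ε : ℂ} (ht : t ∈ ball c r) (hε : ε ∈ V) :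
    HasDerivAt (fun τ => segmentIntegral t₀ f (τ, ε)) (f (t, ε)) t := by
  have hfε : DifferentiableOn ℂ (fun τ => f (τ, ε)) (ball c r) :=
    hf.comp (f := fun τ => (τ, ε)) (by fun_prop) fun τ hτ => ⟨hτ, hε⟩
  obtain ⟨G, hG⟩ := hfε.isExactOn_ball
  refine ((hG t ht).sub_const (G t₀)).congr_of_eventuallyEq ?_
  filter_upwards [isOpen_ball.mem_nhds ht] with τ hτ
  have hmem : ∀ x ∈ uIcc (0 : ℝ) 1, t₀ + x * (τ - t₀) ∈ ball c r := fun x hx =>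
    add_mul_sub_mem_of_convex (convex_ball c r) ht₀ hτ (by rwa [uIcc_of_le zero_le_one] at hx)
  have hint : IntervalIntegrable (fun x : ℝ => (τ - t₀) • f (t₀ + x * (τ - t₀), ε))
      MeasureTheory.volume 0 1 := by
    refine ContinuousOn.intervalIntegrable ?_
    rw [uIcc_of_le zero_le_one]
    exact (continuousOn_segmentIntegrand ht₀ hf.continuousOn).comp (f := fun x => ((τ, ε), x))
      (by fun_prop) fun x hx => ⟨⟨hτ, hε⟩, hx⟩
  have := intervalIntegral.integral_eq_sub_of_hasDerivAt
    (f := fun x : ℝ => G (t₀ + x * (τ - t₀))) (fun x hx => ?_) hint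
  · simpa [segmentIntegral] using this
  · have h₁ : HasDerivAt (fun x : ℝ => t₀ + (x : ℂ) * (τ - t₀)) (τ - t₀) x := by
      simpa using ((Complex.ofRealCLM.hasDerivAt (x := x)).mul_const (τ - t₀)).const_add t₀
    exact (hG _ (hmem x hx)).scomp x h₁

theorem differentiableOn_segmentIntegral [CompleteSpace E] (ht₀ : t₀ ∈ ball c r)
    (hV : IsOpen V) (hf : DifferentiableOn ℂ f (ball c r ×ˢ V)) :
    DifferentiableOn ℂ (segmentIntegral t₀ f) (ball c r ×ˢ V) := by
  have hint := continuousOn_segmentIntegrand ht₀ hf.continuousOn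
  refine differentiableOn_prod_of_separately isOpen_ball hV ?_ ?_ ?_
  · exact continuousOn_intervalIntegral_of_continuousOn zero_le_one hint
  · exact fun w hw z hz =>
      (hasDerivAt_segmentIntegral ht₀ hf hz hw).differentiableAt.differentiableWithinAt
  · intro z hz w hw
    refine (hasDerivAt_intervalIntegral_of_differentiableOn (a := 0) (b := 1)
      (F := fun w x => (z - t₀) • f (t₀ + x * (z - t₀), w)) hV ?_ ?_
      hw).differentiableAt.differentiableWithinAt
    · rw [uIcc_of_le zero_le_one]
      exact hint.comp (f := fun q : ℝ × ℂ => ((z, q.2), q.1)) (by fun_prop)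
        fun q hq => ⟨⟨hz, hq.2⟩, hq.1⟩
    · intro x hx
      rw [uIcc_of_le zero_le_one] at hx
      refine DifferentiableOn.const_smul (hf.comp (f := fun w => (t₀ + x * (z - t₀), w))
        (by fun_prop) fun w hw => ⟨?_, hw⟩) _
      exact add_mul_sub_mem_of_convex (convex_ball c r) ht₀ hz hx

@[simp]
theorem segmentIntegral_self (ε : ℂ) : segmentIntegral t₀ f (t₀, ε) = 0 := by
  simp [segmentIntegral]

/-- Integrating `x ^ k` over `[0, 1]` gains the factor `1 / (k + 1)`; iterated, these factors build
the factorials that make the Picard series converge. -/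
theorem norm_segmentIntegral_le {B : ℝ} {k : ℕ} {p : ℂ × ℂ}
    (hf : ∀ x ∈ Icc (0 : ℝ) 1,
      ‖f (t₀ + x * (p.1 - t₀), p.2)‖ ≤ B * ‖(x : ℂ) * (p.1 - t₀)‖ ^ k) :
    ‖segmentIntegral t₀ f p‖ ≤ B * ‖p.1 - t₀‖ ^ (k + 1) / (k + 1) := by
  have hb : ∀ᵐ x : ℝ, x ∈ Ioc (0 : ℝ) 1 →
      ‖(p.1 - t₀) • f (t₀ + x * (p.1 - t₀), p.2)‖ ≤ B * ‖p.1 - t₀‖ ^ (k + 1) * x ^ k := by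
    refine .of_forall fun x hx => ?_
    rw [norm_smul]
    refine (mul_le_mul_of_nonneg_left (hf x ⟨hx.1.le, hx.2⟩) (norm_nonneg _)).trans_eq ?_
    rw [norm_mul, Complex.norm_real, Real.norm_of_nonneg hx.1.le]
    ring
  refine (intervalIntegral.norm_integral_le_of_norm_le zero_le_one hb
    (Continuous.intervalIntegrable (by fun_prop) _ _)).trans_eq ?_
  rw [intervalIntegral.integral_const_mul, integral_pow]
  simp [div_eq_mul_inv]

end SegmentIntegral

/-! ### Picard iteration with a holomorphic parameter -/

/-- The increments of the Picard iteration for `∂Z/∂t = A(t, ε) Z`, `Z(t₀, ε) = v`. -/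
noncomputable def picardIncrement {E : Type*} [NormedAddCommGroup E] [NormedSpace ℂ E]
    (A : ℂ × ℂ → E →L[ℂ] E) (t₀ : ℂ) (v : E) : ℕ → ℂ × ℂ → E
  | 0 => fun _ => v
  | k + 1 => segmentIntegral t₀ fun p => A p (picardIncrement A t₀ v k p)

section Picard

open Set Metric

variable {E : Type*} [NormedAddCommGroup E] [NormedSpace ℂ E]
  {A : ℂ × ℂ → E →L[ℂ] E} {c t₀ : ℂ} {r : ℝ} {V : Set ℂ}

theorem differentiableOn_picardIncrement [CompleteSpace E] (ht₀ : t₀ ∈ ball c r) (hV : IsOpen V)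
    (hA : DifferentiableOn ℂ A (ball c r ×ˢ V)) (v : E) (k : ℕ) :
    DifferentiableOn ℂ (picardIncrement A t₀ v k) (ball c r ×ˢ V) := by
  induction k with
  | zero => exact differentiableOn_const v
  | succ k ih => exact differentiableOn_segmentIntegral ht₀ hV (hA.clm_apply ih)

theorem norm_picardIncrement_le {K L : Set ℂ} (hK : Convex ℝ K) (ht₀ : t₀ ∈ K) {M : ℝ}
    (hM : ∀ p ∈ K ×ˢ L, ‖A p‖ ≤ M) (v : E) (k : ℕ) {p : ℂ × ℂ} (hp : p ∈ K ×ˢ L) :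
    ‖picardIncrement A t₀ v k p‖ ≤ ‖v‖ * M ^ k / k.factorial * ‖p.1 - t₀‖ ^ k := by
  have hM0 : 0 ≤ M := (norm_nonneg _).trans (hM p hp)
  induction k generalizing p with
  | zero => simp [picardIncrement]
  | succ k ih =>
    refine (norm_segmentIntegral_le (B := M * (‖v‖ * M ^ k / k.factorial)) (k := k)
      fun x hx => ?_).trans_eq ?_
    · have hq : (t₀ + x * (p.1 - t₀), p.2) ∈ K ×ˢ L :=
        ⟨add_mul_sub_mem_of_convex hK ht₀ hp.1 hx, hp.2⟩
      refine (ContinuousLinearMap.le_opNorm _ _).trans ?_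
      have := mul_le_mul (hM _ hq) (ih hq) (norm_nonneg _) hM0
      simpa [mul_assoc] using this
    · rw [Nat.factorial_succ]
      push_cast
      field_simp
      ring

/-- A linear system `∂Z/∂t = A(t, ε) Z` whose coefficients are holomorphic in `(t, ε)` on the
product of a disc and an open set has, for every constant initial value, a solution that is
holomorphic on the whole product. -/
theorem exists_holomorphic_solution_linear_system [CompleteSpace E] (ht₀ : t₀ ∈ ball c r)
    (hV : IsOpen V) (hA : DifferentiableOn ℂ A (ball c r ×ˢ V)) (v : E) :
    ∃ Z : ℂ × ℂ → E, DifferentiableOn ℂ Z (ball c r ×ˢ V) ∧ (∀ ε ∈ V, Z (t₀, ε) = v) ∧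
      ∀ t ∈ ball c r, ∀ ε ∈ V,
        HasDerivAt (fun τ => Z (τ, ε)) (A (t, ε) (Z (t, ε))) t := by
  set P := picardIncrement A t₀ v with hP
  have hPd := differentiableOn_picardIncrement ht₀ hV hA v
  have hPt : ∀ k, ∀ ε ∈ V, DifferentiableOn ℂ (fun t => P k (t, ε)) (ball c r) := fun k ε hε =>
    (hPd k).comp (f := fun t => (t, ε)) (by fun_prop) fun t ht => ⟨ht, hε⟩
  have hPε : ∀ k, ∀ t ∈ ball c r, DifferentiableOn ℂ (fun ε => P k (t, ε)) V := fun k t ht =>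
    (hPd k).comp (f := fun ε => (t, ε)) (by fun_prop) fun ε hε => ⟨ht, hε⟩
  have hbound : ∀ p ∈ ball c r ×ˢ V, ∃ r', ∃ L : Set ℂ, ball c r' ⊆ ball c r ∧ IsOpen L ∧ L ⊆ V ∧
      p ∈ ball c r' ×ˢ L ∧ ∃ u : ℕ → ℝ, Summable u ∧ ∀ k, ∀ q ∈ ball c r' ×ˢ L, ‖P k q‖ ≤ u k := by
    rintro ⟨t, ε⟩ ⟨ht, hε⟩
    -- The smaller disc keeps the centre `c` and contains both `t` and `t₀`, so segments from `t₀`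
    -- stay in a compact convex set on which `A` is bounded.
    obtain ⟨r', hr', hr'r⟩ : ∃ r', max (dist t c) (dist t₀ c) < r' ∧ r' < r :=
      exists_between (max_lt ht ht₀)
    obtain ⟨δ, hδ, hδV⟩ := nhds_basis_closedBall.mem_iff.1 (hV.mem_nhds hε)
    have hsub : closedBall c r' ×ˢ closedBall ε δ ⊆ ball c r ×ˢ V :=
      prod_mono (closedBall_subset_ball hr'r) hδV
    obtain ⟨M, hM⟩ := ((isCompact_closedBall c r').prod
      (isCompact_closedBall ε δ)).exists_bound_of_continuousOn (hA.continuousOn.mono hsub)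
    have ht₀' : t₀ ∈ closedBall c r' := ((le_max_right _ _).trans_lt hr').le
    have hM0 : 0 ≤ M :=
      (norm_nonneg _).trans (hM (t₀, ε) ⟨ht₀', mem_closedBall_self hδ.le⟩)
    refine ⟨r', ball ε δ, ball_subset_ball hr'r.le, isOpen_ball,
      ball_subset_closedBall.trans hδV, ⟨(le_max_left _ _).trans_lt hr', mem_ball_self hδ⟩,
      fun k => ‖v‖ * ((M * (2 * r')) ^ k / k.factorial),
      (Real.summable_pow_div_factorial _).mul_left _, fun k q hq => ?_⟩
    have hq' : q ∈ closedBall c r' ×ˢ closedBall ε δ :=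
      ⟨ball_subset_closedBall hq.1, ball_subset_closedBall hq.2⟩
    refine (norm_picardIncrement_le (convex_closedBall c r') ht₀' hM v k hq').trans ?_
    have hdist : ‖q.1 - t₀‖ ≤ 2 * r' := by
      rw [← dist_eq_norm, two_mul]
      exact (dist_triangle_right _ _ c).trans (add_le_add hq'.1 ht₀')
    calc ‖v‖ * M ^ k / k.factorial * ‖q.1 - t₀‖ ^ k
        ≤ ‖v‖ * M ^ k / k.factorial * (2 * r') ^ k := by gcongr
      _ = ‖v‖ * ((M * (2 * r')) ^ k / k.factorial) := by rw [mul_pow]; ring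
  have hderiv : ∀ t ∈ ball c r, ∀ ε ∈ V, HasDerivAt (fun τ => ∑' k, P k (τ, ε))
      (A (t, ε) (∑' k, P k (t, ε))) t := by
    intro t ht ε hε
    obtain ⟨r', L, hr', hLo, hL, ⟨ht', hεL⟩, u, hu, hle⟩ := hbound (t, ε) ⟨ht, hε⟩
    have hd : ∀ k, DifferentiableOn ℂ (fun τ => P k (τ, ε)) (ball c r') := fun k =>
      (hPt k ε hε).mono hr'
    have hsum := Complex.hasSum_deriv_of_summable_norm hu hd isOpen_ball
      (fun k τ hτ => hle k (τ, ε) ⟨hτ, hεL⟩) ht'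
    have hdiff := (Complex.differentiableOn_tsum_of_summable_norm hu hd isOpen_ball
      fun k τ hτ => hle k (τ, ε) ⟨hτ, hεL⟩).differentiableAt (isOpen_ball.mem_nhds ht')
    have hsP : Summable fun k => P k (t, ε) :=
      hu.of_norm_bounded fun k => hle k (t, ε) ⟨ht', hεL⟩
    have hsum' : HasSum (fun k => deriv (fun τ => P k (τ, ε)) t) (A (t, ε) (∑' k, P k (t, ε))) := by
      -- Index shift: the constant increment `P 0` has derivative zero, and `P (k + 1)` has
      -- derivative `A (P k)`.
      rw [← hasSum_nat_add_iff' 1]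
      have h0 : deriv (fun τ => P 0 (τ, ε)) t = 0 := by simp [hP, picardIncrement]
      have h1 : ∀ k, deriv (fun τ => P (k + 1) (τ, ε)) t = A (t, ε) (P k (t, ε)) := fun k =>
        (hasDerivAt_segmentIntegral ht₀ (hA.clm_apply (hPd k)) ht hε).deriv
      simpa [h0, h1] using (A (t, ε)).hasSum hsP.hasSum
    rw [← hsum.unique hsum']
    exact hdiff.hasDerivAt
  refine ⟨fun p => ∑' k, P k p, ?_, fun ε _ => ?_, hderiv⟩
  · refine differentiableOn_prod_of_separately isOpen_ball hV ?_ ?_ ?_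
    · intro p hp
      obtain ⟨r', L, hr', hLo, hL, hpL, u, hu, hle⟩ := hbound p hp
      exact ((continuousOn_tsum (fun k => ((hPd k).mono (prod_mono hr' hL)).continuousOn) hu
        hle).continuousAt ((isOpen_ball.prod hLo).mem_nhds hpL)).continuousWithinAt
    · exact fun ε hε t ht => (hderiv t ht ε hε).differentiableAt.differentiableWithinAt
    · intro t ht ε hε
      obtain ⟨r', L, hr', hLo, hL, ⟨ht', hεL⟩, u, hu, hle⟩ := hbound (t, ε) ⟨ht, hε⟩
      exact ((Complex.differentiableOn_tsum_of_summable_norm hu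
        (fun k => (hPε k t ht).mono hL) hLo fun k w hw => hle k (t, w) ⟨ht', hw⟩).differentiableAt
        (hLo.mem_nhds hεL)).differentiableWithinAt
  · refine (tsum_eq_single 0 fun k hk => ?_).trans (by simp [hP, picardIncrement])
    obtain ⟨k, rfl⟩ := Nat.exists_eq_succ_of_ne_zero hk
    exact segmentIntegral_self ε

end Picard

/-! ### Zeros of holomorphic functions -/

open Set Metric in
theorem eventually_codiscreteWithin_ne_zero {f : ℂ → ℂ} {U : Set ℂ} (hU : IsOpen U)
    (hU' : IsPreconnected U) (hf : DifferentiableOn ℂ f U) (h : ∃ t ∈ U, f t ≠ 0) :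
    ∀ᶠ t in codiscreteWithin U, f t ≠ 0 :=
  ((hf.analyticOnNhd hU).eqOn_zero_or_eventually_ne_zero_of_preconnected hU').resolve_left
    fun h0 => let ⟨_, ht, hne⟩ := h; hne (h0 ht)

open Set Metric in
theorem not_accPt_zeros {f : ℂ → ℂ} {U : Set ℂ} (hU : IsOpen U)
    (hU' : IsPreconnected U) (hf : DifferentiableOn ℂ f U) (h : ∃ t ∈ U, f t ≠ 0) :
    ∀ t ∈ U, ¬ AccPt t (𝓟 {t ∈ U | f t = 0}) := by
  intro t ht hacc
  refine mem_codiscreteWithin_accPt.1 (eventually_codiscreteWithin_ne_zero hU hU' hf h) t ht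
    (hacc.mono (principal_mono.2 ?_))
  exact fun x hx => ⟨hx.1, fun h => h hx.2⟩

-- The zeros form a discrete set, and discrete subsets of a hereditarily Lindelöf space are
-- countable.
open Set Metric in
theorem countable_zeros {f : ℂ → ℂ} {U : Set ℂ} (hU : IsOpen U)
    (hU' : IsPreconnected U) (hf : DifferentiableOn ℂ f U) (h : ∃ t ∈ U, f t ≠ 0) :
    {t ∈ U | f t = 0}.Countable := by
  have hd : IsDiscrete ({t | f t = 0} ∩ U) := isDiscrete_of_codiscreteWithin
    (eventually_codiscreteWithin_ne_zero hU hU' hf h)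
  refine ((HereditarilyLindelofSpace.isLindelof _).countable_of_isDiscrete hd).mono ?_
  exact fun t ht => ⟨ht.2, ht.1⟩

/-! ### Extracting the lowest-order term from a circle integral -/

open Set Metric in
/-- If `z ^ k * f z` has vanishing integral over a circle for all `k ≥ 1`, then multiplying `f` by
a holomorphic function `h` multiplies the integral by `h 0`. -/
theorem circleIntegral_mul_eq_of_forall_pow_eq_zero {h f : ℂ → ℂ} {ρ R : ℝ} (hρ : 0 < ρ)
    (hρR : ρ < R) (hh : DifferentiableOn ℂ h (closedBall 0 R)) (hf : ContinuousOn f (sphere 0 ρ))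
    (hv : ∀ k : ℕ, 1 ≤ k → (∮ z in C(0, ρ), z ^ k * f z) = 0) :
    (∮ z in C(0, ρ), h z * f z) = h 0 * ∮ z in C(0, ρ), f z := by
  lift R to NNReal using (hρ.trans hρR).le
  lift ρ to NNReal using hρ.le
  have hρR' : ρ < R := hρR
  have hp := hh.hasFPowerSeriesOnBall (hρ.trans hρR)
  set p := cauchyPowerSeries h 0 R
  obtain ⟨ρ', h₁, h₂⟩ := exists_between hρR'
  -- Because `ρ < R`, the Taylor series of `h` at `0` converges uniformly on the circle and can be
  -- integrated termwise; only its constant term survives.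
  have hunif : TendstoUniformlyOn (fun n z => p.partialSum n z) h atTop (sphere 0 ρ) := by
    have := hp.tendstoUniformlyOn (r' := ρ') (by exact_mod_cast h₂)
    simp only [zero_add] at this
    exact this.mono (sphere_subset_closedBall.trans (closedBall_subset_ball h₁))
  obtain ⟨M, hM⟩ := (isCompact_sphere (0 : ℂ) ρ).exists_bound_of_continuousOn hf
  have hunif' : TendstoUniformlyOn (fun n z => p.partialSum n z * f z) (fun z => h z * f z) atTop
      (sphere 0 ρ) := by
    rw [Metric.tendstoUniformlyOn_iff] at hunif ⊢
    intro ε hε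
    filter_upwards [hunif (ε / (|M| + 1)) (by positivity)] with n hn z hz
    rw [dist_eq_norm, ← sub_mul, norm_mul, ← dist_eq_norm]
    calc _ ≤ dist (h z) (p.partialSum n z) * (|M| + 1) := by
          gcongr; exact (hM z hz).trans ((le_abs_self M).trans (by linarith))
      _ < ε := by rw [← lt_div_iff₀ (by positivity)]; exact hn z hz
  have hcont : ∀ n, ContinuousOn (fun z => p.partialSum n z * f z) (sphere 0 ρ) := fun n =>
    (p.partialSum_continuous n).continuousOn.mul hf
  have hlim := hunif'.tendsto_circleIntegral_of_continuousOn (by simp)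
    (.of_forall hcont)
  refine tendsto_nhds_unique hlim (tendsto_const_nhds.congr' ?_)
  filter_upwards [eventually_ge_atTop 1] with n hn
  have hterm : ∀ k, ContinuousOn (fun z => p.coeff k * (z ^ k * f z)) (sphere 0 ρ) := fun k =>
    continuousOn_const.mul ((continuousOn_pow k).mul hf)
  have hsum : ∀ z, p.partialSum n z * f z =
      ∑ k ∈ Finset.range n, p.coeff k * (z ^ k * f z) := by
    intro z
    simp only [FormalMultilinearSeries.partialSum, Finset.sum_mul]
    refine Finset.sum_congr rfl fun k _ => ?_
    rw [FormalMultilinearSeries.apply_eq_pow_smul_coeff, smul_eq_mul]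
    ring
  simp_rw [hsum]
  rw [circleIntegral.integral_fun_sum fun k _ => (hterm k).circleIntegrable hρ.le]
  simp_rw [circleIntegral.integral_const_mul]
  rw [Finset.sum_eq_single_of_mem 0 (Finset.mem_range.2 hn)
    fun k _ hk => by rw [hv k (Nat.one_le_iff_ne_zero.2 hk), mul_zero]]
  have h0 : p.coeff 0 = h 0 := hp.coeff_zero _
  simp [h0]

/-! ### Local uniqueness by orders of vanishing -/

open Set Metric in
theorem le_analyticOrderAt_sum {ι : Type*} (s : Finset ι) {f : ι → ℂ → ℂ} {z : ℂ} {N : ℕ∞}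
    (h : ∀ i ∈ s, N ≤ analyticOrderAt (f i) z) :
    N ≤ analyticOrderAt (fun t => ∑ i ∈ s, f i t) z := by
  classical
  induction s using Finset.induction_on with
  | empty => simp [analyticOrderAt_eq_top.2]
  | insert i s hi ih =>
    simp only [Finset.sum_insert hi]
    exact (le_min (h i (s.mem_insert_self i))
      (ih fun j hj => h j (Finset.mem_insert_of_mem hj))).trans le_analyticOrderAt_add

/-- Uniqueness for a homogeneous linear equation `b_m u⁽ᵐ⁾ + ⋯ + b₀ u = 0` with analytic
coefficients at a point where `b_m` does not vanish: a solution with zero initial data vanishes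
near that point. The sequence `C` consists of `u` and its derivatives. -/
theorem eventually_eq_zero_of_linear_ode {n : ℕ} {b : Fin n → ℂ → ℂ} {C : ℕ → ℂ → ℂ} {z : ℂ}
    (hb : ∀ i, AnalyticAt ℂ (b i) z) (hC : ∀ i, AnalyticAt ℂ (C i) z)
    (hderiv : ∀ i, deriv (C i) =ᶠ[𝓝 z] C (i + 1)) (m : Fin n) (hm : b m z ≠ 0)
    (hgt : ∀ i, m < i → b i =ᶠ[𝓝 z] 0) (hode : ∀ᶠ t in 𝓝 z, ∑ i, b i t * C i t = 0)
    (hinit : ∀ i < (m : ℕ), C i z = 0) : C 0 =ᶠ[𝓝 z] 0 := by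
  -- Bootstrap: if `C 0, …, C m` vanish to order `N`, then each `C i` with `i < m` vanishes to order
  -- `N + 1`, since its derivative has order at least `N` and its value at `z` is zero. The equation
  -- then gives order `N + 1` for `b m * C m`, hence for `C m`, as `b m` is a unit at `z`.
  have key : ∀ N : ℕ, ∀ i ≤ (m : ℕ), (N : ℕ∞) ≤ analyticOrderAt (C i) z := by
    intro N
    induction N with
    | zero => simp
    | succ N ih =>
      have hlt : ∀ i < (m : ℕ), ((N + 1 : ℕ) : ℕ∞) ≤ analyticOrderAt (C i) z := by
        intro i hi
        have := (hC i).analyticOrderAt_deriv_add_one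
        rw [hinit i hi] at this
        simp only [sub_zero] at this
        rw [← this, analyticOrderAt_congr (hderiv i), Nat.cast_succ]
        gcongr
        exact ih (i + 1) hi
      intro i hi
      obtain hi | rfl := hi.lt_or_eq
      · exact hlt i hi
      have hrest : ((N + 1 : ℕ) : ℕ∞) ≤
          analyticOrderAt (fun t => ∑ i ∈ Finset.univ.erase m, b i t * C i t) z := by
        refine le_analyticOrderAt_sum _ fun i hi => ?_
        obtain hlt' | hgt' := (Finset.ne_of_mem_erase hi).lt_or_gt
        · refine (hlt i hlt').trans ?_
          have := analyticOrderAt_mul (hb i) (hC i)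
          change _ ≤ analyticOrderAt (b i * C i) z
          rw [this]
          exact le_add_self
        · have : (fun t => b i t * C i t) =ᶠ[𝓝 z] 0 := by
            filter_upwards [hgt i hgt'] with t ht
            simp [ht]
          rw [analyticOrderAt_eq_top.2 this]
          exact le_top
      have heq : (fun t => ∑ i ∈ Finset.univ.erase m, b i t * C i t) =ᶠ[𝓝 z]
          -(b m * C m) := by
        filter_upwards [hode] with t ht
        rw [← Finset.add_sum_erase _ _ (Finset.mem_univ m)] at ht
        exact (neg_eq_of_add_eq_zero_right ht).symm
      rw [analyticOrderAt_congr heq, analyticOrderAt_neg, analyticOrderAt_mul (hb m) (hC m),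
        (hb m).analyticOrderAt_eq_zero.2 hm, zero_add] at hrest
      exact hrest
  refine analyticOrderAt_eq_top.1 (ENat.eq_top_iff_forall_ge.2 fun N => ?_)
  exact key N 0 (Nat.zero_le _)

/-! ### Laurent coefficients in the parameter -/

/-- Up to the factor `2πi`, the coefficient of `z ^ (-k)` in the Laurent expansion of `f(t, ·)`
at `0`, computed on the circle of radius `ρ`. -/
noncomputable def polarCoeff (ρ : ℝ) (f : ℂ → ℂ → ℂ) (k : ℕ) (t : ℂ) : ℂ :=
  ∮ z in C(0, ρ), z ^ k * (z⁻¹ * f t z)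

section PolarCoeff

open Set Metric

variable {ρ : ℝ}

theorem continuousOn_inv_mul_sphere (hρ : 0 < ρ) {f : ℂ → ℂ} (hf : ContinuousOn f (sphere 0 ρ)) :
    ContinuousOn (fun z => z⁻¹ * f z) (sphere 0 ρ) :=
  (continuousOn_id.inv₀ fun _ hz => ne_zero_of_mem_sphere hρ.ne' ⟨_, hz⟩).mul hf

theorem hasDerivAt_polarCoeff {U : Set ℂ} (hU : IsOpen U) (hρ : 0 < ρ) {f : ℂ → ℂ → ℂ}
    (hf : ContinuousOn (Function.uncurry fun z t => f t z) (sphere 0 ρ ×ˢ U))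
    (hd : ∀ z ∈ sphere (0 : ℂ) ρ, DifferentiableOn ℂ (fun t => f t z) U) (k : ℕ) {t : ℂ}
    (ht : t ∈ U) :
    HasDerivAt (polarCoeff ρ f k) (polarCoeff ρ (fun t z => deriv (fun τ => f τ z) t) k t) t := by
  have hmem : ∀ θ : ℝ, circleMap 0 ρ θ ∈ sphere (0 : ℂ) ρ := fun θ =>
    circleMap_mem_sphere 0 hρ.le θ
  have hne : ∀ θ : ℝ, circleMap 0 ρ θ ≠ 0 := fun θ => circleMap_ne_center hρ.ne'
  have hdiff : ∀ θ : ℝ, DifferentiableOn ℂ (fun t => f t (circleMap 0 ρ θ)) U := fun θ =>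
    hd _ (hmem θ)
  have h := hasDerivAt_intervalIntegral_of_differentiableOn hU (a := 0) (b := 2 * Real.pi)
    (F := fun t θ => deriv (circleMap 0 ρ) θ • (circleMap 0 ρ θ ^ k *
      ((circleMap 0 ρ θ)⁻¹ * f t (circleMap 0 ρ θ)))) ?_ ?_ ht
  · refine h.congr_deriv (intervalIntegral.integral_congr fun θ _ => ?_)
    have hθ := (hdiff θ).differentiableAt (hU.mem_nhds ht)
    rw [deriv_fun_const_smul _ ((hθ.const_mul _).const_mul _), deriv_const_mul _ (hθ.const_mul _),
      deriv_const_mul _ hθ]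
  · have hc := continuous_circleMap (0 : ℂ) ρ
    have h₁ : Continuous fun q : ℝ × ℂ => deriv (circleMap 0 ρ) q.1 := by
      simp only [deriv_circleMap]; fun_prop
    have h₂ : Continuous fun q : ℝ × ℂ => (circleMap 0 ρ q.1)⁻¹ :=
      (hc.comp continuous_fst).inv₀ fun q => hne q.1
    have h₃ : ContinuousOn (fun q : ℝ × ℂ => f q.2 (circleMap 0 ρ q.1))
        (uIcc 0 (2 * Real.pi) ×ˢ U) :=
      hf.comp (f := fun q : ℝ × ℂ => (circleMap 0 ρ q.1, q.2)) (by fun_prop)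
        fun q hq => ⟨hmem q.1, hq.2⟩
    exact h₁.continuousOn.smul ((((hc.comp continuous_fst).pow k).continuousOn).mul
      (h₂.continuousOn.mul h₃))
  · exact fun θ _ => DifferentiableOn.fun_const_smul (((hdiff θ).const_mul _).const_mul _) _

theorem polarCoeff_zero_of_eqOn_const (hρ : 0 < ρ) {f : ℂ → ℂ → ℂ} {t c : ℂ}
    (h : ∀ z ∈ sphere (0 : ℂ) ρ, f t z = c) : polarCoeff ρ f 0 t = 2 * Real.pi * Complex.I * c := by
  have : polarCoeff ρ f 0 t = ∮ z in C(0, ρ), c * (z - 0)⁻¹ :=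
    circleIntegral.integral_congr hρ.le fun z hz => by simp [h z hz, mul_comm]
  rw [this, circleIntegral.integral_const_mul, circleIntegral.integral_sub_center_inv _ hρ.ne']
  ring

/-- A constant has no polar part. Applied to the initial data at `t₀`, this gives every coefficient
of positive index zero initial data. -/
theorem polarCoeff_succ_of_eqOn_const (hρ : 0 < ρ) {f : ℂ → ℂ → ℂ} {t c : ℂ}
    (h : ∀ z ∈ sphere (0 : ℂ) ρ, f t z = c) (k : ℕ) : polarCoeff ρ f (k + 1) t = 0 := by
  have : polarCoeff ρ f (k + 1) t = ∮ z in C(0, ρ), c * (z - 0) ^ (k : ℤ) :=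
    circleIntegral.integral_congr hρ.le fun z hz => by
      have hz0 : z ≠ 0 := ne_zero_of_mem_sphere hρ.ne' ⟨z, hz⟩
      simp only [h z hz, sub_zero, zpow_natCast]
      field_simp
      ring
  rw [this, circleIntegral.integral_const_mul, circleIntegral.integral_sub_zpow_of_ne (by omega),
    mul_zero]

/-- The polar part of a function that is meromorphic at `0` is finite. -/
theorem exists_forall_polarCoeff_eq_zero {W : Set ℂ} (hW : IsOpen W) (hρ : 0 < ρ)
    (hρW : closedBall 0 ρ ⊆ W) {f : ℂ → ℂ → ℂ} {t : ℂ} (hf : DifferentiableOn ℂ (f t) (W \ {0}))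
    (hmer : MeromorphicAt (f t) 0) : ∃ N, ∀ k, N < k → polarCoeff ρ f k t = 0 := by
  obtain ⟨N, hN⟩ := hmer
  simp only [sub_zero, smul_eq_mul] at hN
  refine ⟨N, fun k hk => ?_⟩
  -- With `k = N + j + 1` the factor `z⁻¹` is absorbed: the integrand becomes `z ^ j * (z ^ N * f t
  -- z)`, holomorphic on the closed disc, and Cauchy's theorem applies.
  obtain ⟨j, rfl⟩ := Nat.exists_eq_add_of_lt hk
  have hg : DifferentiableOn ℂ (fun z => z ^ j * (z ^ N * f t z)) (closedBall 0 ρ) := by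
    intro z hz
    by_cases h0 : z = 0
    · subst h0
      exact ((differentiableAt_pow j).mul hN.differentiableAt).differentiableWithinAt
    · have hfz := hf.differentiableAt ((hW.sdiff isClosed_singleton).mem_nhds ⟨hρW hz, h0⟩)
      exact ((differentiableAt_pow j).mul
        ((differentiableAt_pow N).mul hfz)).differentiableWithinAt
  have h0 : (∮ z in C(0, ρ), z ^ j * (z ^ N * f t z)) = 0 :=
    Complex.circleIntegral_eq_zero_of_differentiable_on_off_countable hρ.le countable_empty
      hg.continuousOn fun z hz =>
        hg.differentiableAt (closedBall_mem_nhds_of_mem hz.1)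
  rw [← h0]
  refine circleIntegral.integral_congr hρ.le fun z hz => ?_
  have hz0 : z ≠ 0 := ne_zero_of_mem_sphere hρ.ne' ⟨z, hz⟩
  field_simp
  ring

end PolarCoeff

/-! ### Infinitely many nonzero polar coefficients -/

section ParamSolution

open Set Metric

variable {n s : ℕ} {a : Fin n → ℂ → ℂ → ℂ} {U W : Set ℂ} {y : ℂ → ℂ → ℂ}

theorem DifferentiableOn.slice_left {f : ℂ → ℂ → ℂ} {V : Set ℂ}
    (hf : DifferentiableOn ℂ (fun p : ℂ × ℂ => f p.1 p.2) (U ×ˢ V)) {ε : ℂ} (hε : ε ∈ V) :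
    DifferentiableOn ℂ (fun t => f t ε) U :=
  hf.comp (f := fun t => (t, ε)) (by fun_prop) fun _ ht => ⟨ht, hε⟩

theorem DifferentiableOn.slice_right {f : ℂ → ℂ → ℂ} {V : Set ℂ}
    (hf : DifferentiableOn ℂ (fun p : ℂ × ℂ => f p.1 p.2) (U ×ˢ V)) {t : ℂ} (ht : t ∈ U) :
    DifferentiableOn ℂ (f t) V :=
  hf.comp (f := fun ε => (t, ε)) (by fun_prop) fun _ hε => ⟨ht, hε⟩

theorem differentiableOn_iteratedDeriv_of_isOpen {f : ℂ → ℂ} (hU : IsOpen U)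
    (hf : DifferentiableOn ℂ f U) (i : ℕ) : DifferentiableOn ℂ (iteratedDeriv i f) U := by
  induction i with
  | zero => simpa using hf
  | succ i ih => rw [iteratedDeriv_succ]; exact ih.deriv hU

theorem continuousOn_iteratedDeriv_of_differentiableOn_prod {V : Set ℂ} (hU : IsOpen U)
    (hy : DifferentiableOn ℂ (fun p : ℂ × ℂ => y p.1 p.2) (U ×ˢ V)) (i : ℕ) :
    ContinuousOn (Function.uncurry fun ε t => iteratedDeriv i (fun τ => y τ ε) t) (V ×ˢ U) := by
  induction i with
  | zero =>
    simp only [iteratedDeriv_zero]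
    exact hy.continuousOn.comp continuous_swap.continuousOn fun p hp => ⟨hp.2, hp.1⟩
  | succ i ih =>
    simp only [iteratedDeriv_succ]
    exact continuousOn_deriv_of_continuousOn_uncurry hU ih fun ε hε =>
      differentiableOn_iteratedDeriv_of_isOpen hU (hy.slice_left hε) i

/-- A parameter dependent solution of a singularly perturbed equation whose initial data at `t₀`
are constant in `ε` and do not satisfy the limit equation has a pole or removable singularity at
`ε = 0` for at most countably many values of `t`. -/
theorem IsParamSolution.countable_setOf_meromorphicAt (hU : IsOpen U) (hU' : IsPreconnected U)
    (hW : IsOpen W) (h0 : (0 : ℂ) ∈ W) (ha : IsSingularlyPerturbed s a U W)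
    (hy : IsParamSolution s a U (W \ {0}) y) {t₀ : ℂ} (ht₀ : t₀ ∈ U) (m : Fin n)
    (hm : a m t₀ 0 ≠ 0) (hgt : ∀ i, m < i → ∀ t ∈ U, a i t 0 = 0) {c : Fin n → ℂ}
    (hc : ∀ ε ∈ W \ {0}, ∀ i : Fin n, iteratedDeriv (i : ℕ) (fun t => y t ε) t₀ = c i)
    (hac : ∑ i, a i t₀ 0 * c i ≠ 0) :
    {t ∈ U | MeromorphicAt (y t) 0}.Countable := by
  obtain ⟨R, hR, hRW⟩ := nhds_basis_closedBall.mem_iff.1 (hW.mem_nhds h0)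
  -- The circle is strictly inside a closed disc on which the coefficients are holomorphic, as the
  -- termwise integration of their Taylor series requires.
  obtain ⟨ρ, hρ, hρR⟩ := exists_between hR
  have hρW : closedBall 0 ρ ⊆ W := (closedBall_subset_closedBall hρR.le).trans hRW
  have hsphere : sphere 0 ρ ⊆ W \ {0} := fun z hz =>
    ⟨hρW (sphere_subset_closedBall hz), ne_zero_of_mem_sphere hρ.ne' ⟨z, hz⟩⟩
  let d : ℕ → ℂ → ℂ → ℂ := fun i t ε => iteratedDeriv i (fun τ => y τ ε) t
  have hdcont : ∀ i, ContinuousOn (Function.uncurry fun ε t => d i t ε) (sphere 0 ρ ×ˢ U) :=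
    fun i => (continuousOn_iteratedDeriv_of_differentiableOn_prod hU hy.holomorphic i).mono
      (prod_mono_left hsphere)
  have hddiff : ∀ i, ∀ z ∈ sphere (0 : ℂ) ρ, DifferentiableOn ℂ (fun t => d i t z) U :=
    fun i z hz => differentiableOn_iteratedDeriv_of_isOpen hU
      (hy.holomorphic.slice_left (hsphere hz)) i
  have hslice : ∀ i, ∀ t ∈ U, ContinuousOn (d i t) (sphere 0 ρ) := fun i t ht =>
    (hdcont i).comp (f := fun z => (z, t)) (by fun_prop) fun z hz => ⟨hz, ht⟩
  let C : ℕ → ℕ → ℂ → ℂ := fun k i => polarCoeff ρ (d i) k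
  have hC : ∀ k i, ∀ t ∈ U, HasDerivAt (C k i) (C k (i + 1) t) t := by
    intro k i t ht
    have := hasDerivAt_polarCoeff hU hρ (hdcont i) (hddiff i) k ht
    simpa only [C, d, iteratedDeriv_succ] using this
  have hCdiff : ∀ k i, DifferentiableOn ℂ (C k i) U := fun k i t ht =>
    (hC k i t ht).differentiableAt.differentiableWithinAt
  have hzero : ∀ k, (∀ t ∈ U, C k 0 t = 0) → ∀ i, ∀ t ∈ U, C k i t = 0 := by
    intro k hk i
    induction i with
    | zero => exact hk
    | succ i ih =>
      intro t ht
      refine (hC k i t ht).unique ((hasDerivAt_const t (0 : ℂ)).congr_of_eventuallyEq ?_)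
      filter_upwards [hU.mem_nhds ht] with τ hτ using ih τ hτ
  -- The lowest order term of the equation.
  have hlead : ∀ K, (∀ k, K < k → ∀ t ∈ U, C k 0 t = 0) →
      ∀ t ∈ U, ∑ i, a i t 0 * C K i t = 0 := by
    intro K hK t ht
    have hcoeff : ∀ i : Fin n, (∮ z in C(0, ρ), a i t z * (z ^ K * (z⁻¹ * d i t z))) =
        a i t 0 * C K i t := by
      intro i
      refine circleIntegral_mul_eq_of_forall_pow_eq_zero hρ hρR
        (((ha.holomorphic i).slice_right ht).mono hRW)
        ((continuousOn_pow K).mul (continuousOn_inv_mul_sphere hρ (hslice i t ht))) fun k hk => ?_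
      simp_rw [← mul_assoc, ← pow_add]
      simp_rw [mul_assoc]
      exact hzero (k + K) (hK _ (by omega)) i t ht
    -- Here `s ≥ 1` enters: the singular factor raises the index to `s + K > K`, so the term of
    -- order `n` drops out.
    have htop : (∮ z in C(0, ρ), z ^ (s + K) * (z⁻¹ * d n t z)) = 0 :=
      hzero (s + K) (hK _ (by have := ha.one_le; omega)) n t ht
    have hint : ∀ i : Fin n, CircleIntegrable (fun z => a i t z * (z ^ K * (z⁻¹ * d i t z))) 0 ρ :=
      fun i => ((((ha.holomorphic i).slice_right ht).continuousOn.mono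
        (hsphere.trans sdiff_subset)).mul ((continuousOn_pow K).mul
          (continuousOn_inv_mul_sphere hρ (hslice i t ht)))).circleIntegrable hρ.le
    have hsum := circleIntegral.integral_fun_sum (s := Finset.univ) fun i _ => hint i
    simp_rw [hcoeff] at hsum
    have hcongr : (∮ z in C(0, ρ), ∑ i : Fin n, a i t z * (z ^ K * (z⁻¹ * d i t z))) =
        ∮ z in C(0, ρ), (-1) * (z ^ (s + K) * (z⁻¹ * d n t z)) := by
      refine circleIntegral.integral_congr hρ.le fun z hz => ?_
      have heq := hy.equation t ht z (hsphere hz)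
      have hfac : ∑ i : Fin n, a i t z * (z ^ K * (z⁻¹ * d i t z)) =
          z ^ K * z⁻¹ * ∑ i : Fin n, a i t z * d i t z := by
        rw [Finset.mul_sum]
        exact Finset.sum_congr rfl fun i _ => by ring
      simp only [hfac, pow_add]
      linear_combination (z ^ K * z⁻¹) * heq
    rw [← hsum, hcongr, circleIntegral.integral_const_mul, htop, mul_zero]
  have hinit0 : ∀ i : Fin n, C 0 i t₀ = 2 * Real.pi * Complex.I * c i := fun i =>
    polarCoeff_zero_of_eqOn_const hρ fun z hz => hc z (hsphere hz) i
  have hinit : ∀ k, ∀ i : Fin n, C (k + 1) i t₀ = 0 := fun k i =>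
    polarCoeff_succ_of_eqOn_const hρ (fun z hz => hc z (hsphere hz) i) k
  have hunbounded : ∀ N, ∃ k, N < k ∧ ∃ t ∈ U, C k 0 t ≠ 0 := by
    by_contra! hbdd
    have hvanish : ∀ K, ∀ k, K < k → ∀ t ∈ U, C k 0 t = 0 := by
      obtain ⟨N, hN⟩ := hbdd
      have hstep : ∀ K, (∀ k, K + 1 < k → ∀ t ∈ U, C k 0 t = 0) → ∀ t ∈ U, C (K + 1) 0 t = 0 := by
        intro K hK
        have hode := hlead (K + 1) hK
        have hlocal : C (K + 1) 0 =ᶠ[𝓝 t₀] 0 := by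
          refine eventually_eq_zero_of_linear_ode (b := fun i t => a i t 0)
            (fun i => ((ha.holomorphic i).slice_left h0).analyticAt (hU.mem_nhds ht₀))
            (fun i => (hCdiff _ i).analyticAt (hU.mem_nhds ht₀)) (fun i => ?_) m hm
            (fun i hi => ?_) ?_ fun i hi => hinit K ⟨i, hi.trans m.2⟩
          · filter_upwards [hU.mem_nhds ht₀] with t ht using (hC _ i t ht).deriv
          · filter_upwards [hU.mem_nhds ht₀] with t ht using hgt i hi t ht
          · filter_upwards [hU.mem_nhds ht₀] with t ht using hode t ht
        exact ((hCdiff (K + 1) 0).analyticOnNhd hU).eqOn_zero_of_preconnected_of_eventuallyEq_zero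
          hU' ht₀ hlocal
      -- Descending induction on `K`, with `j` bounding how far `K` lies below `N`; it stops at `K =
      -- 0` because the initial data vanish only for positive index.
      have hdown : ∀ j K, N ≤ K + j → ∀ k, K < k → ∀ t ∈ U, C k 0 t = 0 := by
        intro j
        induction j with
        | zero => exact fun K hK k hk => hN k (by omega)
        | succ j ih =>
          intro K hK k hk
          have h := ih (K + 1) (by omega)
          obtain rfl | hlt := (Nat.succ_le_of_lt hk).eq_or_lt
          · exact hstep K h
          · exact h k hlt
      exact fun K => hdown N K (by omega)
    refine hac ?_
    -- At index `0` the initial data are `2πi c`, so the limit equation at `t₀` contradicts `hac`.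
    have h := hlead 0 (hvanish 0) t₀ ht₀
    simp_rw [hinit0] at h
    have hfac : ∑ i, a i t₀ 0 * (2 * Real.pi * Complex.I * c i) =
        2 * Real.pi * Complex.I * ∑ i, a i t₀ 0 * c i := by
      rw [Finset.mul_sum]
      exact Finset.sum_congr rfl fun i _ => by ring
    exact (mul_eq_zero.1 (hfac ▸ h)).resolve_left Complex.two_pi_I_ne_zero
  choose k hk hne using hunbounded
  refine (countable_iUnion fun N => countable_zeros hU hU' (hCdiff (k N) 0) (hne N)).mono ?_
  rintro t ⟨ht, hmer⟩
  have hd0 : DifferentiableOn ℂ (d 0 t) (W \ {0}) := by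
    simpa only [d, iteratedDeriv_zero] using hy.holomorphic.slice_right ht
  obtain ⟨N, hN⟩ := exists_forall_polarCoeff_eq_zero hW hρ hρW (f := d 0) hd0
    (by simpa only [d, iteratedDeriv_zero] using hmer)
  exact mem_iUnion.2 ⟨N, ht, hN _ (hk N)⟩

end ParamSolution

/-! ### Solutions with prescribed constant initial data -/

section Existence

open Set Metric

/-- On a finite-dimensional source an operator is the finite sum of its coordinate projections times
its values on the standard basis, so holomorphy can be tested on vectors. -/
theorem differentiableOn_clm_of_apply {ι D F : Type*} [Fintype ι] [DecidableEq ι]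
    [NormedAddCommGroup D] [NormedSpace ℂ D] [NormedAddCommGroup F] [NormedSpace ℂ F]
    {f : D → (ι → ℂ) →L[ℂ] F} {s : Set D} (hf : ∀ v, DifferentiableOn ℂ (fun x => f x v) s) :
    DifferentiableOn ℂ f s := by
  have heq : f = fun x => ∑ j, ContinuousLinearMap.smulRightL ℂ (ι → ℂ) F
      (ContinuousLinearMap.proj j) (f x (Pi.single j 1)) := by
    ext x v
    conv_lhs => rw [pi_eq_sum_univ' v, map_sum]
    simp
  rw [heq]
  exact DifferentiableOn.fun_sum fun j _ =>
    (ContinuousLinearMap.differentiable _).comp_differentiableOn (hf (Pi.single j 1))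

/-- The companion system of `ε ^ s * y⁽ⁿ⁾ + ∑ i, a i * y⁽ⁱ⁾ = 0`. -/
noncomputable def companionSystem {n : ℕ} (s : ℕ) (a : Fin n → ℂ → ℂ → ℂ) (p : ℂ × ℂ) :
    (Fin n → ℂ) →L[ℂ] (Fin n → ℂ) :=
  ContinuousLinearMap.pi fun i =>
    if h : (i : ℕ) + 1 < n then ContinuousLinearMap.proj ⟨i + 1, h⟩
    else ∑ j, (-(a j p.1 p.2 / p.2 ^ s)) • ContinuousLinearMap.proj j

variable {n s : ℕ} {a : Fin n → ℂ → ℂ → ℂ}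

theorem companionSystem_apply_of_lt (p : ℂ × ℂ) (v : Fin n → ℂ) {i : Fin n}
    (h : (i : ℕ) + 1 < n) : companionSystem s a p v i = v ⟨i + 1, h⟩ := by
  simp [companionSystem, h]

theorem companionSystem_apply_of_not_lt (p : ℂ × ℂ) (v : Fin n → ℂ) {i : Fin n}
    (h : ¬ (i : ℕ) + 1 < n) :
    companionSystem s a p v i = ∑ j, -(a j p.1 p.2 / p.2 ^ s) * v j := by
  simp [companionSystem, h]

theorem differentiableOn_companionSystem {U V : Set ℂ} (hV : ∀ ε ∈ V, ε ≠ 0)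
    (ha : ∀ i, DifferentiableOn ℂ (fun p : ℂ × ℂ => a i p.1 p.2) (U ×ˢ V)) :
    DifferentiableOn ℂ (companionSystem s a) (U ×ˢ V) := by
  refine differentiableOn_clm_of_apply fun v => differentiableOn_pi.2 fun i => ?_
  by_cases h : (i : ℕ) + 1 < n
  · simp_rw [companionSystem_apply_of_lt _ v h]
    exact differentiableOn_const _
  · simp_rw [companionSystem_apply_of_not_lt _ v h]
    refine DifferentiableOn.fun_sum fun j _ => DifferentiableOn.mul_const (.fun_neg ?_) _
    simp only [div_eq_mul_inv]
    exact (ha j).fun_mul (DifferentiableOn.fun_inv (by fun_prop)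
      fun p hp => pow_ne_zero s (hV _ hp.2))

/-- Global solvability, with prescribed initial data that do not depend on the parameter. -/
theorem exists_isParamSolution {c t₀ : ℂ} {r : ℝ} {V : Set ℂ} (hn : 0 < n) (ht₀ : t₀ ∈ ball c r)
    (hV : IsOpen V) (hV0 : ∀ ε ∈ V, ε ≠ 0)
    (ha : ∀ i, DifferentiableOn ℂ (fun p : ℂ × ℂ => a i p.1 p.2) (ball c r ×ˢ V))
    (v : Fin n → ℂ) :
    ∃ y : ℂ → ℂ → ℂ, IsParamSolution s a (ball c r) V y ∧
      ∀ ε ∈ V, ∀ i : Fin n, iteratedDeriv (i : ℕ) (fun t => y t ε) t₀ = v i := by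
  obtain ⟨Z, hZ, hZ₀, hZd⟩ := exists_holomorphic_solution_linear_system ht₀ hV
    (differentiableOn_companionSystem (s := s) hV0 ha) v
  have hcomp : ∀ i : Fin n, ∀ t ∈ ball c r, ∀ ε ∈ V, HasDerivAt (fun τ => Z (τ, ε) i)
      (companionSystem s a (t, ε) (Z (t, ε)) i) t := fun i t ht ε hε =>
    hasDerivAt_pi.1 (hZd t ht ε hε) i
  let y : ℂ → ℂ → ℂ := fun t ε => Z (t, ε) ⟨0, hn⟩
  have hiter : ∀ i (hi : i < n), ∀ ε ∈ V, ∀ t ∈ ball c r,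
      iteratedDeriv i (fun τ => y τ ε) t = Z (t, ε) ⟨i, hi⟩ := by
    intro i
    induction i with
    | zero => simp [y]
    | succ i ih =>
      intro hi ε hε t ht
      have hd := hcomp ⟨i, by omega⟩ t ht ε hε
      rw [companionSystem_apply_of_lt _ _ hi] at hd
      rw [iteratedDeriv_succ, ← hd.deriv]
      refine EventuallyEq.deriv_eq ?_
      filter_upwards [isOpen_ball.mem_nhds ht] with τ hτ using ih (by omega) ε hε τ hτ
  refine ⟨y, ⟨?_, fun t ht ε hε => ?_⟩, fun ε hε i => ?_⟩
  · exact differentiableOn_pi.1 hZ ⟨0, hn⟩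
  · obtain ⟨k, rfl⟩ := Nat.exists_eq_succ_of_ne_zero hn.ne'
    have hd := hcomp ⟨k, by omega⟩ t ht ε hε
    rw [companionSystem_apply_of_not_lt _ _ (by simp)] at hd
    have htop : iteratedDeriv (k + 1) (fun τ => y τ ε) t =
        ∑ j, -(a j t ε / ε ^ s) * Z (t, ε) j := by
      rw [iteratedDeriv_succ, ← hd.deriv]
      refine EventuallyEq.deriv_eq ?_
      filter_upwards [isOpen_ball.mem_nhds ht] with τ hτ using hiter k (by omega) ε hε τ hτ
    rw [htop, Finset.mul_sum, ← Finset.sum_add_distrib]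
    refine Finset.sum_eq_zero fun j _ => ?_
    rw [hiter j j.2 ε hε t ht]
    have := pow_ne_zero s (hV0 ε hε)
    field_simp
    ring
  · rw [hiter i i.2 ε hε t₀ ht₀, hZ₀ ε hε]

end Existence

/-! ### The exceptional sets and the choice of initial data -/

theorem lemma4p1 (n s : ℕ) (a : Fin n → ℂ → ℂ → ℂ) (cU cW : ℂ) (rU rW : ℝ)
    (h0 : (0 : ℂ) ∈ Metric.ball cW rW)
    (ha : IsSingularlyPerturbed s a (Metric.ball cU rU) (Metric.ball cW rW)) :
    ∃ D : Set ℂ, D ⊆ Metric.ball cU rU ∧ (∀ t ∈ Metric.ball cU rU, ¬ AccPt t (𝓟 D)) ∧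
      ∀ t₀ ∈ Metric.ball cU rU \ D, ∃ y : ℂ → ℂ → ℂ,
        IsParamSolution s a (Metric.ball cU rU) (Metric.ball cW rW \ {0}) y ∧
        (∃ c : Fin n → ℂ, ∀ ε ∈ Metric.ball cW rW \ {0}, ∀ i : Fin n,
          iteratedDeriv (i : ℕ) (fun t => y t ε) t₀ = c i) ∧
        ∃ E : Set ℂ, E ⊆ Metric.ball cU rU ∧ E.Countable ∧
          ∀ t₁ ∈ Metric.ball cU rU \ E, HasEssentialSingularityAt (fun ε => y t₁ ε) 0 := by
  have hpre : IsPreconnected (Metric.ball cU rU) := (convex_ball cU rU).isPreconnected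
  -- `m` is the order of the limit equation, the largest index whose coefficient survives at `ε =
  -- 0`.
  obtain ⟨m, ⟨t', ht', hmt'⟩, hmax⟩ : ∃ m : Fin n, (∃ t ∈ Metric.ball cU rU, a m t 0 ≠ 0) ∧
      ∀ i, m < i → ∀ t ∈ Metric.ball cU rU, a i t 0 = 0 := by
    obtain ⟨k, hk⟩ := ha.exists_ne_zero
    obtain ⟨m, hm, hmax⟩ := (Set.toFinite
      {k : Fin n | ∃ t ∈ Metric.ball cU rU, a k t 0 ≠ 0}).exists_maximal ⟨k, hk⟩
    refine ⟨m, hm, fun i hi t ht => ?_⟩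
    by_contra hne
    exact absurd (hmax (y := i) ⟨t, ht, hne⟩ hi.le) (not_le.2 hi)
  refine ⟨{t ∈ Metric.ball cU rU | a m t 0 = 0}, fun t ht => ht.1,
    not_accPt_zeros Metric.isOpen_ball hpre ((ha.holomorphic m).slice_left h0) ⟨t', ht', hmt'⟩, ?_⟩
  rintro t₀ ⟨ht₀, hD⟩
  have hm : a m t₀ 0 ≠ 0 := fun h => hD ⟨ht₀, h⟩
  have hopen : IsOpen (Metric.ball cW rW \ {0}) := Metric.isOpen_ball.sdiff isClosed_singleton
  -- With the `m`-th unit vector as data, the limit equation at `t₀` would read `a m t₀ 0 = 0`,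
  -- which is false off `D`.
  obtain ⟨y, hy, hc⟩ := exists_isParamSolution (s := s) m.pos ht₀ hopen (fun ε hε => hε.2)
    (fun i => (ha.holomorphic i).mono (Set.prod_mono_right Set.sdiff_subset)) (Pi.single m 1)
  refine ⟨y, hy, ⟨_, hc⟩, {t ∈ Metric.ball cU rU | MeromorphicAt (y t) 0}, fun t ht => ht.1,
    hy.countable_setOf_meromorphicAt Metric.isOpen_ball hpre Metric.isOpen_ball h0 ha ht₀ m hm hmax
      hc (by simpa [Pi.single_apply] using hm), ?_⟩
  rintro t₁ ⟨ht₁, hE⟩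
  refine ⟨?_, fun hmer => hE ⟨ht₁, hmer⟩⟩
  filter_upwards [nhdsWithin_le_nhds (Metric.isOpen_ball.mem_nhds h0), self_mem_nhdsWithin]
    with z hz hz0
  exact (hy.holomorphic.slice_right ht₁).differentiableAt (hopen.mem_nhds ⟨hz, hz0⟩)
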